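/- For a bounded real sequence $x=(x(n))_{n\in\mathbb{N}}\in\ell_\infty$ (real scalars), a number $\eta\in\mathbb{R}$ is an accumulation point of $x$ if $\{n\in\mathbb{N}: |x(n)-\eta|<\varepsilon\}$ is infinite for every $\varepsilon>0$. For a cardinal $\kappa$, let $\mathrm{L}(\kappa)$ be the set of all $x\in\ell_\infty$ having exactly $\kappa$ accumulation points. A subset $M$ of a vector space is called $2$-lineable if $M\cup\{0\}$ contains a linear subspace of dimension $2$. Let $(a_n)_{n\ge 0}$ be an increasing sequence of natural numbers such that $a_0\ge 2$ and $a_{n+1}>2a_n$ for all $n\ge 0$. Then $\bigcup_{n\ge 0}\mathrm{L}(a_n)$ is not $2$-lineable. In particular, $\bigcup_{n\ge 2}\mathrm{L}(n!)$ and $\bigcup_{n\ge 1}\mathrm{L}(3^n)$ are not $2$-lineable. -/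

import Mathlib

open scoped ENNReal lp Nat

universe u v

/-- A subset `M` of a `𝕜`-vector space `X` is `κ`-lineable if `M ∪ {0}` contains a linear
subspace of (algebraic) dimension `κ`. -/
def IsLineable (𝕜 : Type v) {X : Type u} [Field 𝕜] [AddCommGroup X] [Module 𝕜 X]
    (κ : Cardinal.{u}) (M : Set X) : Prop :=
  ∃ V : Submodule 𝕜 X, Module.rank 𝕜 V = κ ∧ (V : Set X) ⊆ M ∪ {0}

/-- The set `L_x` of accumulation points of a bounded real sequence `x`: the reals `η` such that
`x n` is `ε`-close to `η` for infinitely many `n`, for every `ε > 0`. -/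
def accumulationPoints (x : ℓ^∞(ℕ, ℝ)) : Set ℝ :=
  {η : ℝ | ∀ ε : ℝ, 0 < ε → {n : ℕ | |x n - η| < ε}.Infinite}

/-- The set `L(κ)` of bounded real sequences with exactly `κ` accumulation points. -/
def seqWithAccumulationPoints (κ : Cardinal.{0}) : Set ℓ^∞(ℕ, ℝ) :=
  {x | Cardinal.mk (accumulationPoints x) = κ}

/-!
The linear combinations of two bounded sequences have as accumulation points the values of the
linear forms on `ℝ²` at a set `Q` of joint cluster points. If each nonzero form takes a finite
number of values, at least two, then `Q` is finite and not collinear. Fix a form `u` that is not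
injective on `Q` and an independent form `w`. In the pencil `w + t u` the last member that is not
injective on `Q` is similarly ordered to `u`, so the two embed `Q` as a chain in the product of
their images, and `|Q|` is less than the sum of their numbers of values. Every later member is
injective, so `|Q|` is itself such a number. If each of these numbers is at least twice any
smaller one, the sum is at most `|Q|`, a contradiction.
-/

open Filter Topology

section SimilarlyOrdered

variable {ι α β : Type*}

theorem injOn_add_of_monovaryOn [AddCommMonoid α] [LinearOrder α] [IsOrderedCancelAddMonoid α]
    {f g : ι → α} {s : Set ι} (hfg : MonovaryOn f g s)
    (hinj : s.InjOn fun i => (f i, g i)) : s.InjOn (f + g) := by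
  intro i hi j hj hij
  have hij : f i + g i = f j + g j := hij
  rcases lt_trichotomy (g i) (g j) with h | h | h
  · exact absurd hij (add_lt_add_of_le_of_lt (hfg hi hj h) h).ne
  · exact hinj hi hj (Prod.ext (add_right_cancel (h ▸ hij)) h)
  · exact absurd hij (add_lt_add_of_le_of_lt (hfg hj hi h) h).ne'

theorem exists_monotone_injOn_lt_card [LinearOrder α] (T : Finset α) :
    ∃ r : α → ℕ, Monotone r ∧ Set.InjOn r T ∧ ∀ a ∈ T, r a < T.card := by
  have hmono : Monotone fun a => (T.filter (· < a)).card := fun a b hab =>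
    Finset.card_le_card (Finset.monotone_filter_right T fun _ _ hc => hc.trans_le hab)
  have hstrict : StrictMonoOn (fun a => (T.filter (· < a)).card) T := fun a ha b _ hab =>
    Finset.card_lt_card <| (Finset.ssubset_iff_of_subset
      (Finset.monotone_filter_right T fun _ _ hc => hc.trans hab)).2 ⟨a, by simp_all⟩
  exact ⟨_, hmono, hstrict.injOn, fun a ha => Finset.card_lt_card <|
    Finset.filter_ssubset.2 ⟨a, ha, lt_irrefl a⟩⟩

theorem card_lt_card_image_add_card_image_of_monovaryOn [LinearOrder α] [LinearOrder β]
    {f : ι → α} {g : ι → β} {s : Finset ι} (hs : s.Nonempty) (hfg : MonovaryOn f g s)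
    (hinj : Set.InjOn (fun i => (f i, g i)) s) :
    s.card < (s.image f).card + (s.image g).card := by
  obtain ⟨r, hr, hr_inj, hr_lt⟩ := exists_monotone_injOn_lt_card (s.image f)
  obtain ⟨r', hr', hr'_inj, hr'_lt⟩ := exists_monotone_injOn_lt_card (s.image g)
  have hranks : MonovaryOn (r ∘ f) (r' ∘ g) s :=
    ((hfg.comp_monotone_on_left hr).symm.comp_monotone_on_left hr').symm
  have hranks_inj : Set.InjOn (fun i => ((r ∘ f) i, (r' ∘ g) i)) s := fun i hi j hj hij =>
    hinj hi hj (Prod.ext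
      (hr_inj (Finset.mem_image_of_mem f hi) (Finset.mem_image_of_mem f hj) (congrArg Prod.fst hij))
      (hr'_inj (Finset.mem_image_of_mem g hi) (Finset.mem_image_of_mem g hj)
        (congrArg Prod.snd hij)))
  have hmaps : Set.MapsTo (r ∘ f + r' ∘ g) s
      (Finset.range ((s.image f).card + (s.image g).card - 1)) := fun i hi => by
    have hf := hr_lt _ (Finset.mem_image_of_mem f hi)
    have hg := hr'_lt _ (Finset.mem_image_of_mem g hi)
    simp only [Finset.coe_range, Set.mem_Iio, Pi.add_apply, Function.comp_apply]
    omega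
  have hcard := Finset.card_le_card_of_injOn _ hmaps (injOn_add_of_monovaryOn hranks hranks_inj)
  have := (hs.image f).card_pos
  rw [Finset.card_range] at hcard
  omega

end SimilarlyOrdered

section Perp

variable {K : Type*} [CommRing K]

/-- The plane vector `v` turned clockwise by a right angle. Its linear form `perp v ⬝ᵥ ·` identifies
two points exactly when their difference is parallel to `v ≠ 0`. -/
def perp (v : Fin 2 → K) : Fin 2 → K := ![v 1, -v 0]

theorem perp_dotProduct (v z : Fin 2 → K) : perp v ⬝ᵥ z = v 1 * z 0 - v 0 * z 1 := by
  rw [Matrix.vec2_dotProduct]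
  exact (congrArg _ (neg_mul _ _)).trans (sub_eq_add_neg _ _).symm

theorem perp_dotProduct_self (v : Fin 2 → K) : perp v ⬝ᵥ v = 0 := by
  rw [perp_dotProduct, mul_comm, sub_self]

theorem perp_ne_zero {v : Fin 2 → K} (hv : v ≠ 0) : perp v ≠ 0 := fun h => hv <|
  funext <| Fin.forall_fin_two.2
    ⟨neg_eq_zero.1 (congrFun h 1), congrFun h 0⟩

end Perp

section LinearForms

variable {ι K : Type*} [Field K] [LinearOrder K] [IsStrictOrderedRing K]

theorem exists_monovaryOn_add_smul_not_injOn {Q : Finset ι} {u : ι → K} (w : ι → K)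
    (hu : (u '' Q).Nontrivial) :
    ∃ t : K, MonovaryOn (w + t • u) u Q ∧ ¬ Set.InjOn (w + t • u) Q := by
  let pairs := (Q ×ˢ Q).filter fun z => u z.1 < u z.2
  let slope : ι × ι → K := fun z => (w z.1 - w z.2) / (u z.2 - u z.1)
  have hpairs : pairs.Nonempty := by
    obtain ⟨_, ⟨i, hi, rfl⟩, _, ⟨j, hj, rfl⟩, hij⟩ := hu.exists_lt
    exact ⟨(i, j), by simp_all [pairs]⟩
  -- `w + t • u` identifies `i` and `j` exactly when `t = slope (i, j)`.
  obtain ⟨⟨p, q⟩, hpq, hmax⟩ := pairs.exists_max_image slope hpairs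
  simp only [pairs, Finset.mem_filter, Finset.mem_product, and_imp, Prod.forall] at hpq hmax
  obtain ⟨⟨hp, hq⟩, hupq⟩ := hpq
  refine ⟨slope (p, q), fun i hi j hj hij => ?_, fun hinj => hupq.ne (congrArg u ?_)⟩
  · have := (div_le_iff₀ (sub_pos.2 hij)).1 (hmax i j hi hj hij)
    simp only [Pi.add_apply, Pi.smul_apply, smul_eq_mul]
    linarith
  · have : slope (p, q) * (u q - u p) = w p - w q := div_mul_cancel₀ _ (sub_pos.2 hupq).ne'
    refine hinj hp hq ?_
    simp only [Pi.add_apply, Pi.smul_apply, smul_eq_mul]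
    linarith

theorem exists_card_lt_card_image_add_card_image_add_smul {Q : Finset ι} {u w : ι → K}
    (hu : (u '' Q).Nontrivial) (huw : Set.InjOn (fun i => (u i, w i)) Q) :
    ∃ t : K, ¬ Set.InjOn (w + t • u) Q ∧ Set.InjOn (w + (t + 1) • u) Q ∧
      Q.card < (Q.image (w + t • u)).card + (Q.image u).card := by
  obtain ⟨t, hmono, hnot_inj⟩ := exists_monovaryOn_add_smul_not_injOn w hu
  have hjoint : Set.InjOn (fun i => ((w + t • u) i, u i)) Q := fun i hi j hj hij => by
    simp only [Pi.add_apply, Pi.smul_apply, Prod.mk.injEq] at hij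
    obtain ⟨hw, hu⟩ := hij
    rw [hu] at hw
    exact huw hi hj (Prod.ext hu (add_right_cancel hw))
  have hinj : Set.InjOn (w + (t + 1) • u) Q := by
    rw [add_smul, one_smul, ← add_assoc]
    exact injOn_add_of_monovaryOn hmono hjoint
  have hQ : Q.Nonempty := Finset.coe_nonempty.1 hu.nonempty.of_image
  exact ⟨t, hnot_inj, hinj, card_lt_card_image_add_card_image_of_monovaryOn hQ hmono hjoint⟩

theorem injective_perp_dotProduct_prod_dotProduct {v : Fin 2 → K} (hv : v ≠ 0) :
    Function.Injective fun z => (perp v ⬝ᵥ z, v ⬝ᵥ z) := by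
  intro z z' h
  simp only [perp_dotProduct, Matrix.vec2_dotProduct v, Prod.mk.injEq] at h
  obtain ⟨hperp, hself⟩ := h
  have hnorm : v 0 * v 0 + v 1 * v 1 ≠ 0 := by
    rwa [← Matrix.vec2_dotProduct, Ne, dotProduct_self_eq_zero]
  refine funext (Fin.forall_fin_two.2
    ⟨mul_left_cancel₀ hnorm ?_, mul_left_cancel₀ hnorm ?_⟩)
  · linear_combination v 1 * hperp + v 0 * hself
  · linear_combination v 1 * hself - v 0 * hperp

theorem add_smul_perp_ne_zero {v : Fin 2 → K} (hv : v ≠ 0) (t : K) : v + t • perp v ≠ 0 :=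
  fun h => hv <| dotProduct_self_eq_zero.1 <| by
    simpa only [add_dotProduct, smul_dotProduct, perp_dotProduct_self, smul_zero, add_zero,
      zero_dotProduct] using congrArg (· ⬝ᵥ v) h

theorem exists_card_lt_card_image_dotProduct_add_card_image_dotProduct {Q : Finset (Fin 2 → K)}
    (hQ : ∀ c : Fin 2 → K, c ≠ 0 → ((c ⬝ᵥ ·) '' (Q : Set (Fin 2 → K))).Nontrivial) :
    ∃ c d e : Fin 2 → K, c ≠ 0 ∧ d ≠ 0 ∧ e ≠ 0 ∧
      ¬ Set.InjOn (c ⬝ᵥ ·) Q ∧ ¬ Set.InjOn (d ⬝ᵥ ·) Q ∧ Set.InjOn (e ⬝ᵥ ·) Q ∧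
      Q.card < (Q.image (c ⬝ᵥ ·)).card + (Q.image (d ⬝ᵥ ·)).card := by
  obtain ⟨p, hp, q, hq, hpq⟩ := Set.nontrivial_of_image _ _ (hQ 1 one_ne_zero)
  set v := p - q with hv_def
  have hv : v ≠ 0 := sub_ne_zero.2 hpq
  have hperp : ¬ Set.InjOn (perp v ⬝ᵥ ·) Q := fun h => hpq <| h hp hq <| sub_eq_zero.1 <| by
    rw [← dotProduct_sub, ← hv_def, perp_dotProduct_self]
  have hpencil : ∀ s : K,
      ((v ⬝ᵥ ·) + s • (perp v ⬝ᵥ ·) : (Fin 2 → K) → K) = ((v + s • perp v) ⬝ᵥ ·) :=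
    fun s => by ext z; simp [add_dotProduct]
  obtain ⟨t, hnot_inj, hinj, hcard⟩ := exists_card_lt_card_image_add_card_image_add_smul
    (hQ _ (perp_ne_zero hv)) (injective_perp_dotProduct_prod_dotProduct hv).injOn
  rw [hpencil] at hnot_inj hinj hcard
  exact ⟨_, _, _, add_smul_perp_ne_zero hv t, perp_ne_zero hv, add_smul_perp_ne_zero hv (t + 1),
    hnot_inj, hperp, hinj, hcard⟩

theorem not_forall_card_image_dotProduct_mem {A : Set ℕ} (hA : ∀ k ∈ A, 2 ≤ k)
    (hgap : ∀ k ∈ A, ∀ l ∈ A, k < l → 2 * k ≤ l) (Q : Finset (Fin 2 → K)) :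
    ¬ ∀ c : Fin 2 → K, c ≠ 0 → (Q.image (c ⬝ᵥ ·)).card ∈ A := by
  intro h
  obtain ⟨c, d, e, hc, hd, he, hc_inj, hd_inj, he_inj, hcard⟩ :=
    exists_card_lt_card_image_dotProduct_add_card_image_dotProduct (Q := Q) fun c hc => by
      rw [← Finset.coe_image, ← Finset.Nontrivial, ← Finset.one_lt_card_iff_nontrivial]
      exact hA _ (h c hc)
  have hQ : Q.card ∈ A := Finset.card_image_of_injOn he_inj ▸ h e he
  have two_mul_card_le : ∀ b : Fin 2 → K, b ≠ 0 → ¬ Set.InjOn (b ⬝ᵥ ·) Q →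
      2 * (Q.image (b ⬝ᵥ ·)).card ≤ Q.card := fun b hb hb_inj =>
    hgap _ (h b hb) _ hQ (Finset.card_image_le.lt_of_ne (mt Finset.card_image_iff.1 hb_inj))
  have := two_mul_card_le c hc hc_inj
  have := two_mul_card_le d hd hd_inj
  omega

end LinearForms

theorem setOf_mapClusterPt_comp_eq_image {ι E Y : Type*} [TopologicalSpace E] [TopologicalSpace Y]
    [T2Space Y] {F : Filter ι} {u : ι → E} {S : Set E} {f : E → Y} (hS : IsCompact S)
    (hu : ∀ i, u i ∈ S) (hf : Continuous f) :
    {y | MapClusterPt y F (f ∘ u)} = f '' {z | MapClusterPt z F u} := by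
  refine Set.Subset.antisymm (fun y hy => ?_) ?_
  · let G := F ⊓ comap (f ∘ u) (𝓝 y)
    have hG : G.NeBot := by
      rw [← map_neBot_iff (f ∘ u), Filter.push_pull, inf_comm]
      exact hy
    obtain ⟨z, -, hz⟩ := hS.exists_mapClusterPt (f := G) (u := u)
      (le_principal_iff.2 (mem_map.2 (univ_mem' hu)))
    have hfz : ClusterPt (f z) (𝓝 y) :=
      (hz.continuousAt_comp hf.continuousAt).clusterPt.mono
        (tendsto_comap.mono_left inf_le_right)
    exact ⟨z, hz.mono inf_le_left, eq_of_nhds_neBot hfz⟩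
  · rintro _ ⟨z, hz, rfl⟩
    exact MapClusterPt.continuousAt_comp hf.continuousAt hz

theorem accumulationPoints_eq_setOf_mapClusterPt (x : ℓ^∞(ℕ, ℝ)) :
    accumulationPoints x = {η | MapClusterPt η atTop x} := by
  ext η
  rw [Set.mem_ofPred_eq, Metric.nhds_basis_ball.mapClusterPt_iff_frequently]
  refine forall₂_congr fun ε _ => ?_
  rw [Nat.frequently_atTop_iff_infinite]
  rfl

theorem mem_seqWithAccumulationPoints_natCast {x : ℓ^∞(ℕ, ℝ)} {k : ℕ} :
    x ∈ seqWithAccumulationPoints (k : Cardinal) ↔ (accumulationPoints x).encard = k :=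
  Cardinal.toENat_eq_natCast.symm

/-- The joint cluster points of a family of bounded sequences: the cluster points of the sequence
`n ↦ (x i n)ᵢ` in `ℝ^ι`. -/
def jointClusterPoints {ι : Type*} (x : ι → ℓ^∞(ℕ, ℝ)) : Set (ι → ℝ) :=
  {z | MapClusterPt z atTop fun n i => x i n}

theorem accumulationPoints_sum_smul {ι : Type*} [Fintype ι] (x : ι → ℓ^∞(ℕ, ℝ)) (c : ι → ℝ) :
    accumulationPoints (∑ i, c i • x i) = (c ⬝ᵥ ·) '' jointClusterPoints x := by
  have hcoe : ⇑(∑ i, c i • x i) = (c ⬝ᵥ ·) ∘ fun n i => x i n := by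
    ext n
    rw [lp.coeFn_sum, Finset.sum_apply]
    rfl
  rw [accumulationPoints_eq_setOf_mapClusterPt, hcoe]
  exact setOf_mapClusterPt_comp_eq_image
    (isCompact_univ_pi fun i => isCompact_closedBall (0 : ℝ) ‖x i‖)
    (fun n i _ => mem_closedBall_zero_iff.2 (lp.norm_apply_le_norm ENNReal.top_ne_zero (x i) n))
    (continuous_const.dotProduct continuous_id)

theorem finite_jointClusterPoints {ι : Type*} [Finite ι] {x : ι → ℓ^∞(ℕ, ℝ)}
    (hx : ∀ i, (accumulationPoints (x i)).Finite) : (jointClusterPoints x).Finite := by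
  classical
  have := Fintype.ofFinite ι
  refine Set.forall_finite_image_eval_iff.1 fun i => ?_
  have hcoord : accumulationPoints (x i) = Function.eval i '' jointClusterPoints x := by
    simpa [Pi.single_apply] using accumulationPoints_sum_smul x (Pi.single i (1 : ℝ))
  exact hcoord ▸ hx i

theorem IsLineable.exists_forall_sum_smul_mem {𝕜 E : Type*} [Field 𝕜] [AddCommGroup E] [Module 𝕜 E]
    {n : ℕ} {M : Set E} (h : IsLineable 𝕜 n M) :
    ∃ x : Fin n → E, ∀ c : Fin n → 𝕜, c ≠ 0 → ∑ i, c i • x i ∈ M := by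
  obtain ⟨V, hV, hVM⟩ := h
  have : Module.Finite 𝕜 V := Module.rank_lt_aleph0_iff.1 (hV ▸ Cardinal.natCast_lt_aleph0)
  let b := Module.finBasisOfFinrankEq 𝕜 V (Module.finrank_eq_of_rank_eq hV)
  refine ⟨fun i => b i, fun c hc => ?_⟩
  have hb : ((b.equivFun.symm c : V) : E) = ∑ i, c i • (b i : E) := by
    simp [Module.Basis.equivFun_symm_apply]
  rw [← hb]
  exact (hVM (b.equivFun.symm c).2).resolve_right fun h0 => hc <|
    (b.equivFun.symm.map_eq_zero_iff).1 (Subtype.ext h0)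

theorem mainTheorem8_general {ι : Type*} (a : ι → ℕ) (ha : ∀ i, 2 ≤ a i)
    (hgap : ∀ i j, a i < a j → 2 * a i ≤ a j) :
    ¬ IsLineable ℝ 2 (⋃ i, seqWithAccumulationPoints (a i : Cardinal)) := by
  intro h
  obtain ⟨x, hx⟩ := IsLineable.exists_forall_sum_smul_mem (n := 2) (mod_cast h)
  simp only [Set.mem_iUnion, mem_seqWithAccumulationPoints_natCast] at hx
  have hfin : (jointClusterPoints x).Finite := finite_jointClusterPoints fun j => by
    obtain ⟨i, hi⟩ := hx (Pi.single j (1 : ℝ)) (Pi.single_ne_zero_iff.2 one_ne_zero)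
    exact Set.finite_of_encard_eq_coe (k := a i) (by simpa [Pi.single_apply] using hi)
  refine not_forall_card_image_dotProduct_mem (A := Set.range a) (Set.forall_mem_range.2 ha)
    (Set.forall_mem_range.2 fun i => Set.forall_mem_range.2 (hgap i)) hfin.toFinset fun c hc => ?_
  obtain ⟨i, hi⟩ := hx c hc
  refine ⟨i, ?_⟩
  rw [accumulationPoints_sum_smul, ← hfin.coe_toFinset, ← Finset.coe_image,
    Set.encard_coe_eq_coe_finsetCard] at hi
  exact_mod_cast hi.symm

theorem two_mul_le_of_lt_of_two_mul_le_succ {a : ℕ → ℕ} {k : ℕ}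
    (ha : ∀ n, k ≤ n → 2 * a n ≤ a (n + 1)) {m n : ℕ} (hm : k ≤ m) (hn : k ≤ n)
    (hmn : a m < a n) : 2 * a m ≤ a n := by
  have hmono : MonotoneOn a (Set.Ici k) := monotoneOn_nat_Ici_of_le_succ fun n hn => by
    have := ha n hn
    omega
  have hlt : m < n := hmono.reflect_lt hm hn hmn
  exact (ha m hm).trans (hmono (Nat.le_succ_of_le hm) hn hlt)

theorem mainTheorem8 :
    (∀ a : ℕ → ℕ, StrictMono a → 2 ≤ a 0 → (∀ n : ℕ, 2 * a n < a (n + 1)) →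
      ¬ IsLineable ℝ 2 (⋃ n : ℕ, seqWithAccumulationPoints (a n : Cardinal))) ∧
    ¬ IsLineable ℝ 2
      (⋃ n : {n : ℕ // 2 ≤ n}, seqWithAccumulationPoints (((n : ℕ)! : ℕ) : Cardinal)) ∧
    ¬ IsLineable ℝ 2
      (⋃ n : {n : ℕ // 1 ≤ n}, seqWithAccumulationPoints ((3 ^ (n : ℕ) : ℕ) : Cardinal)) := by
  refine ⟨fun a hmono h₀ hgap => ?_, ?_, ?_⟩
  · exact mainTheorem8_general a (fun n => h₀.trans (hmono.monotone n.zero_le)) fun m n =>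
      two_mul_le_of_lt_of_two_mul_le_succ (fun n _ => (hgap n).le) m.zero_le n.zero_le
  · have hgap : ∀ n, 2 ≤ n → 2 * n ! ≤ (n + 1)! := fun n hn => by
      rw [Nat.factorial_succ]
      exact Nat.mul_le_mul_right _ (Nat.le_succ_of_le hn)
    exact mainTheorem8_general _ (fun n => n.2.trans (Nat.self_le_factorial n)) fun m n =>
      two_mul_le_of_lt_of_two_mul_le_succ hgap m.2 n.2
  · have hgap : ∀ n, 1 ≤ n → 2 * 3 ^ n ≤ 3 ^ (n + 1) := fun n _ => by
      rw [pow_succ']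
      exact Nat.mul_le_mul_right _ (by norm_num)
    have htwo_le : ∀ n : {n : ℕ // 1 ≤ n}, 2 ≤ 3 ^ (n : ℕ) := fun n =>
      (Nat.succ_le_succ n.2).trans (Nat.lt_pow_self (by norm_num))
    exact mainTheorem8_general _ htwo_le fun m n =>
      two_mul_le_of_lt_of_two_mul_le_succ hgap m.2 n.2
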